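/- Let $d,n\ge 1$ be integers. Index the entries of a tensor $\mathcal T\in\otimes^{2d}\mathbb C^n$ by pairs $(I,J)$ with $I,J\in\{1,\dots,n\}^d$, and put $\langle\mathcal T,\mathcal Y\rangle=\sum_{I,J}\mathcal T_{I,J}\overline{\mathcal Y_{I,J}}$. Let $\|\cdot\|$ be the Euclidean norm on $\mathbb C^n$. The spectral norm and the nuclear norm of $\mathcal T$ are $$\|\mathcal T\|_\infty=\max\Big\{|\langle\mathcal T,\otimes_{k=1}^{2d}\mathbf x_k\rangle| : \mathbf x_k\in\mathbb C^n,\ \|\mathbf x_k\|=1\Big\},$$ $$\|\mathcal T\|_1=\min\Big\{\sum_{i=1}^r\prod_{k=1}^{2d}\|\mathbf x_{i,k}\| : r\in\mathbb N,\ \mathbf x_{i,k}\in\mathbb C^n,\ \mathcal T=\sum_{i=1}^r\otimes_{k=1}^{2d}\mathbf x_{i,k}\Big\}.$$ Let $\mathrm S^d\mathbb C^n\otimes\mathrm S^d\mathbb C^n\subset\otimes^{2d}\mathbb C^n$ be the subspace of bisymmetric tensors, i.e. those symmetric in the first $d$ indices and in the last $d$ indices separately. Let $\mathbb H_{bsym}$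 be the real space of bisymmetric tensors $\mathcal A$ that are hermitian, i.e. $\mathcal A_{J,I}=\overline{\mathcal A_{I,J}}$ for all $I,J$. For $\mathbf x,\mathbf y\in\mathbb C^n$ put $$\mathcal E(\mathbf x,\mathbf y)=\tfrac12\big((\otimes^d\mathbf x)\otimes(\otimes^d\mathbf y)+(\otimes^d\bar{\mathbf y})\otimes(\otimes^d\bar{\mathbf x})\big).$$ (a) For every $\mathcal C\in\mathrm S^d\mathbb C^n\otimes\mathrm S^d\mathbb C^n$, $$\|\mathcal C\|_\infty=\max\{\Re\langle\mathcal C,(\otimes^d\mathbf x)\otimes(\otimes^d\mathbf y)\rangle : \mathbf x,\mathbf y\in\mathbb C^n,\ \|\mathbf x\|=\|\mathbf y\|=1\},$$ $$\|\mathcal C\|_1=\min\Big\{\sum_{i=1}^M\|\mathbf x_i\|^d\|\mathbf y_i\|^d : M\in\mathbb N,\ \mathbf x_i,\mathbf y_i\in\mathbb C^n,\ \mathcal C=\sum_{i=1}^M(\otimes^d\mathbf x_i)\otimes(\otimes^d\mathbf y_i)\Big\}.$$ (b) For every $\mathcal A\in\mathbb H_{bsym}$, $$\|\mathcal A\|_\infty=\max\{\Re\langle\mathcal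 A,\mathcal E(\mathbf x,\mathbf y)\rangle : \mathbf x,\mathbf y\in\mathbb C^n,\ \|\mathbf x\|=\|\mathbf y\|=1\},$$ $$\|\mathcal A\|_1=\min\Big\{\sum_{i=1}^M\|\mathbf x_i\|^d\|\mathbf y_i\|^d : M\in\mathbb N,\ \mathbf x_i,\mathbf y_i\in\mathbb C^n,\ \mathcal A=\sum_{i=1}^M\mathcal E(\mathbf x_i,\mathbf y_i)\Big\}.$$ (c) Every extreme point of the unit ball $\{\mathcal A\in\mathbb H_{bsym} : \|\mathcal A\|_1\le1\}$ of the nuclear norm restricted to $\mathbb H_{bsym}$ is of the form $\mathcal E(\mathbf x,\mathbf y)$ with $\mathbf x,\mathbf y\in\mathbb C^n$, $\|\mathbf x\|=\|\mathbf y\|=1$; and this unit ball is the convex hull of the set of all these tensors. -/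

import Mathlib

open scoped ComplexConjugate

namespace BisymTensor

/-- Complex tensors all of whose modes have dimension `n`, with modes labelled by `ι`,
given by their arrays of entries. For `ι` with `k` elements this is `⊗^k ℂ^n`. -/
abbrev Tensor (ι : Type) (n : ℕ) : Type := (ι → Fin n) → ℂ

section General

variable {ι : Type} [Fintype ι] {n : ℕ}

/-- The standard inner product, linear in the first and conjugate-linear in the second argument. -/
noncomputable def tInner [DecidableEq ι] (T Y : Tensor ι n) : ℂ := ∑ I, T I * conj (Y I)

/-- The decomposable tensor `⊗_k x_k`. -/
noncomputable def pureTensor (x : ι → EuclideanSpace ℂ (Fin n)) : Tensor ι n :=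
  fun I => ∏ k, x k (I k)

/-- The spectral norm: the maximum of `|⟨T, ⊗_k x_k⟩|` over unit vectors `x_k`. -/
noncomputable def spectralNorm [DecidableEq ι] (T : Tensor ι n) : ℝ :=
  sSup {r : ℝ | ∃ x : ι → EuclideanSpace ℂ (Fin n),
    (∀ k, ‖x k‖ = 1) ∧ r = ‖tInner T (pureTensor x)‖}

/-- The nuclear norm: the minimum of `∑_i ∏_k ‖x_{i,k}‖` over all decompositions
`T = ∑_i ⊗_k x_{i,k}` into finitely many decomposable tensors. -/
noncomputable def nuclearNorm (T : Tensor ι n) : ℝ :=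
  sInf {s : ℝ | ∃ (r : ℕ) (x : Fin r → ι → EuclideanSpace ℂ (Fin n)),
    T = ∑ i, pureTensor (x i) ∧ s = ∑ i, ∏ k, ‖x i k‖}

end General

/-- Tensors with `2d` modes: the first `d` modes are `Sum.inl k`, the last `d` are `Sum.inr k`. -/
abbrev BiTensor (d n : ℕ) : Type := Tensor (Fin d ⊕ Fin d) n

/-- `S^d ℂ^n ⊗ S^d ℂ^n` as the subspace of `⊗^{2d} ℂ^n` of the tensors that are symmetric in the
first `d` indices and in the last `d` indices separately. -/
def bisymmetric (d n : ℕ) : Submodule ℂ (BiTensor d n) where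
  carrier := {C | ∀ (σ τ : Equiv.Perm (Fin d)) (I : Fin d ⊕ Fin d → Fin n),
    C (I ∘ Sum.map σ τ) = C I}
  add_mem' {A B} hA hB σ τ I := by
    rw [Pi.add_apply, Pi.add_apply, hA σ τ I, hB σ τ I]
  zero_mem' _ _ _ := rfl
  smul_mem' c A hA σ τ I := by
    rw [Pi.smul_apply, Pi.smul_apply, hA σ τ I]

/-- The real space of hermitian tensors: exchanging the first `d` indices with the last `d`
indices conjugates the entry. -/
noncomputable def hermitian (d n : ℕ) : Submodule ℝ (BiTensor d n) where
  carrier := {A | ∀ I : Fin d ⊕ Fin d → Fin n, A (I ∘ Sum.swap) = conj (A I)}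
  add_mem' {A B} hA hB I := by
    rw [Pi.add_apply, Pi.add_apply, hA I, hB I, map_add]
  zero_mem' I := by simp
  smul_mem' c A hA I := by
    rw [Pi.smul_apply, Pi.smul_apply, hA I, Complex.real_smul, Complex.real_smul, map_mul,
      Complex.conj_ofReal]

/-- The real space of hermitian bisymmetric tensors. -/
noncomputable def hermitianBisymmetric (d n : ℕ) : Submodule ℝ (BiTensor d n) :=
  hermitian d n ⊓ (bisymmetric d n).restrictScalars ℝ

/-- The tensor `(⊗^d x) ⊗ (⊗^d y)`. -/
noncomputable def biPow (d : ℕ) {n : ℕ} (x y : EuclideanSpace ℂ (Fin n)) : BiTensor d n :=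
  pureTensor (Sum.elim (fun _ => x) (fun _ => y))

/-- The entrywise complex conjugate of a vector. -/
noncomputable def conjVec {n : ℕ} (x : EuclideanSpace ℂ (Fin n)) : EuclideanSpace ℂ (Fin n) :=
  WithLp.toLp 2 (fun j => conj (x j))

/-- The hermitian symmetrization `½ ((⊗^d x) ⊗ (⊗^d y) + (⊗^d ȳ) ⊗ (⊗^d x̄))`. -/
noncomputable def hermPow (d : ℕ) {n : ℕ} (x y : EuclideanSpace ℂ (Fin n)) : BiTensor d n :=
  (1 / 2 : ℂ) • (biPow d x y + biPow d (conjVec y) (conjVec x))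

/-- The hermitian symmetrizations `½ ((⊗^d x) ⊗ (⊗^d y) + (⊗^d ȳ) ⊗ (⊗^d x̄))` of unit vectors. -/
def hermPowSet (d n : ℕ) : Set (BiTensor d n) :=
  {E | ∃ x y : EuclideanSpace ℂ (Fin n), ‖x‖ = 1 ∧ ‖y‖ = 1 ∧ E = hermPow d x y}

/-- The unit ball of the restriction of the nuclear norm to the hermitian bisymmetric tensors. -/
def hermNuclearBall (d n : ℕ) : Set (BiTensor d n) :=
  {A | A ∈ hermitianBisymmetric d n ∧ nuclearNorm A ≤ 1}

end BisymTensor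

/-! Everything rests on Banach's theorem for symmetric multilinear forms. If unit vectors `x i`, `x
j` in two exchangeable slots give a maximum, polarization and the parallelogram law show that the
normalization of `x i + x j`, put in both slots, gives the same maximum. Choosing the maximizer that
also maximizes a suitable linear quantity forces `x i = x j`
(`exists_unit_isMax_of_swap_invariant`). For a bisymmetric tensor the spectral norm is thus attained
at some `biPow d x y`, and a `d`-th root of a phase absorbed into `x` makes the pairing real and
nonnegative.

The nuclear statement follows by duality. If `C` lay outside `nuclearNorm C` times the compact hull
of the unit tensors `biPow d x y`, a functional would separate it. On bisymmetric tensors this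
functional is pairing with a bisymmetric `Y`, whose spectral norm is attained on those same tensors,
contradicting `norm_tInner_le`.

The hermitian case is the image of this under the real projection `hermPart`, which sends `biPow d x
y` to `hermPow d x y`. It keeps real parts of pairings with hermitian tensors and the cost of
decompositions. -/

namespace BisymTensor

/-! ### Compactness of convex hulls. -/

section ConvexHull

/-- In a finite-dimensional space, the convex hull of a compact set is compact. -/
theorem isCompact_convexHull_of_finiteDimensional {E : Type*} [NormedAddCommGroup E]
    [NormedSpace ℝ E] [FiniteDimensional ℝ E] {s : Set E} (hs : IsCompact s) :
    IsCompact (convexHull ℝ s) := by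
  -- Carathéodory: affinely independent points number at most `finrank + 1`, so the hull is a finite
  -- union of continuous images of compact sets.
  have key : convexHull ℝ s = ⋃ m ∈ Set.Iic (Module.finrank ℝ E + 1),
      (fun p : (Fin m → ℝ) × (Fin m → E) => ∑ i, p.1 i • p.2 i) ''
        (stdSimplex ℝ (Fin m) ×ˢ Set.univ.pi fun _ => s) := by
    ext x
    simp only [Set.mem_iUnion, Set.mem_image, Set.mem_prod, Prod.exists, Set.mem_univ_pi,
      exists_prop, Set.mem_Iic]
    constructor
    · intro hx
      obtain ⟨ι, _, z, w, hz, hind, hw, hw1, rfl⟩ := eq_pos_convex_span_of_mem_convexHull hx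
      refine ⟨Fintype.card ι, hind.card_le_finrank_succ.trans
          (Nat.add_le_add_right (Submodule.finrank_le _) 1),
        w ∘ (Fintype.equivFin ι).symm, z ∘ (Fintype.equivFin ι).symm,
        ⟨⟨fun i => (hw _).le, ?_⟩, fun i => hz ⟨_, rfl⟩⟩, ?_⟩
      · rw [← hw1]
        exact (Fintype.equivFin ι).symm.sum_comp w
      · exact (Fintype.equivFin ι).symm.sum_comp fun i => w i • z i
    · rintro ⟨m, -, w, z, ⟨hw, hz⟩, rfl⟩
      exact mem_convexHull_of_exists_fintype w z hw.1 hw.2 hz rfl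
  rw [key]
  refine (Set.finite_Iic _).isCompact_biUnion fun m _ => ?_
  exact ((isCompact_stdSimplex ℝ (Fin m)).prod (isCompact_univ_pi fun _ => hs)).image
    (by fun_prop)

end ConvexHull

/-! ### Banach's theorem on symmetric multilinear forms. -/

section Banach

variable {ι : Type*} [Fintype ι] {E : Type*} [NormedAddCommGroup E]

theorem norm_le_mul_prod_norm_of_unit [NormedSpace ℂ E]
    (G : MultilinearMap ℂ (fun _ : ι => E) ℂ) {B : ℝ}
    (hB : ∀ y : ι → E, (∀ k, ‖y k‖ = 1) → ‖G y‖ ≤ B) (y : ι → E) :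
    ‖G y‖ ≤ B * ∏ k, ‖y k‖ := by
  by_cases h : ∃ k, y k = 0
  · obtain ⟨k, hk⟩ := h
    rw [G.map_coord_zero k hk, Finset.prod_eq_zero (Finset.mem_univ k) (by simp [hk])]
    simp
  · push Not at h
    have hy : y = fun k => ((‖y k‖ : ℝ) : ℂ) • (((‖y k‖ : ℝ) : ℂ)⁻¹ • y k) := by
      funext k
      rw [smul_inv_smul₀]
      exact_mod_cast (norm_ne_zero_iff.mpr (h k))
    conv_lhs => rw [hy]
    rw [G.map_smul_univ, norm_smul, norm_prod, mul_comm]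
    simp only [Complex.norm_real, norm_norm]
    refine mul_le_mul_of_nonneg_right (hB _ fun k => ?_)
      (Finset.prod_nonneg fun k _ => norm_nonneg _)
    rw [norm_smul, norm_inv, Complex.norm_real, norm_norm,
      inv_mul_cancel₀ (norm_ne_zero_iff.mpr (h k))]

/-- If a multilinear form attains its norm at `x` and is invariant under exchanging the arguments
`i` and `j`, then it attains its norm when both are replaced by the normalization of `x i + x j`. -/
theorem norm_le_norm_update_normalize_add [DecidableEq ι] [InnerProductSpace ℂ E]
    (G : MultilinearMap ℂ (fun _ : ι => E) ℂ) {x : ι → E} (hx : ∀ k, ‖x k‖ = 1)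
    (hmax : ∀ y : ι → E, (∀ k, ‖y k‖ = 1) → ‖G y‖ ≤ ‖G x‖) {i j : ι} (hij : i ≠ j)
    (hG : ∀ y : ι → E, G (y ∘ Equiv.swap i j) = G y) (h0 : x i + x j ≠ 0) :
    ‖G x‖ ≤ ‖G (Function.update (Function.update x i (((‖x i + x j‖ : ℝ) : ℂ)⁻¹ • (x i + x j)))
      j (((‖x i + x j‖ : ℝ) : ℂ)⁻¹ • (x i + x j)))‖ := by
  set B : E → E → ℂ := fun u v => G (Function.update (Function.update x i u) j v) with hBdef
  have hBsymm : ∀ u v, B u v = B v u := by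
    intro u v
    simp only [hBdef]
    rw [← hG]
    congr 1
    funext k
    by_cases hki : k = i
    · subst hki; simp [Function.update_of_ne hij]
    · by_cases hkj : k = j
      · subst hkj; simp [Function.update_of_ne hij]
      · simp [Equiv.swap_apply_of_ne_of_ne hki hkj, hki, hkj]
  have hBaddr : ∀ u v w, B u (v + w) = B u v + B u w := fun u v w => G.map_update_add _ _ _ _
  have hBsmulr : ∀ (c : ℂ) u v, B u (c • v) = c * B u v := fun c u v => G.map_update_smul _ _ _ _
  have hBaddl : ∀ u v w, B (v + w) u = B v u + B w u := by
    intro u v w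
    rw [hBsymm, hBaddr, hBsymm u v, hBsymm u w]
  have hBsmull : ∀ (c : ℂ) u v, B (c • u) v = c * B u v := by
    intro c u v
    rw [hBsymm, hBsmulr, hBsymm]
  have hBx : B (x i) (x j) = G x := by simp [hBdef]
  have hBle : ∀ u, ‖B u u‖ ≤ ‖G x‖ * ‖u‖ ^ 2 := by
    intro u
    refine (norm_le_mul_prod_norm_of_unit G hmax _).trans (le_of_eq ?_)
    congr 1
    rw [← Finset.mul_prod_erase _ _ (Finset.mem_univ j),
      ← Finset.mul_prod_erase _ _ (Finset.mem_erase.mpr ⟨hij, Finset.mem_univ i⟩),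
      Finset.prod_eq_one]
    · simp [Function.update_of_ne hij, sq]
    · intro k hk
      simp only [Finset.mem_erase] at hk
      simp [hk.1, hk.2.1, hx]
  have hpol : 4 * G x = B (x i + x j) (x i + x j)
      - B (x i + (-1 : ℂ) • x j) (x i + (-1 : ℂ) • x j) := by
    simp only [hBaddr, hBaddl, hBsmull, hBsmulr, hBsymm (x j) (x i), hBx]
    ring
  have hpar := parallelogram_law_with_norm ℂ (x i) (x j)
  rw [hx i, hx j] at hpar
  -- The parallelogram law gives `‖x i + x j‖ ^ 2 + ‖x i - x j‖ ^ 2 = 4`, so bounding the difference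
  -- term by maximality leaves exactly the bound needed on the sum term.
  have h1 : 4 * ‖G x‖ ≤ ‖B (x i + x j) (x i + x j)‖ + ‖G x‖ * ‖x i - x j‖ ^ 2 := by
    calc 4 * ‖G x‖ = ‖4 * G x‖ := by simp
      _ ≤ _ := by
        rw [hpol]
        refine (norm_sub_le _ _).trans (add_le_add le_rfl ?_)
        simpa [sub_eq_add_neg] using hBle (x i + (-1 : ℂ) • x j)
  have h2 : ‖G x‖ * ‖x i + x j‖ ^ 2 ≤ ‖B (x i + x j) (x i + x j)‖ := by
    have : ‖x i - x j‖ ^ 2 = 4 - ‖x i + x j‖ ^ 2 := by nlinarith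
    rw [this] at h1
    linarith
  have hpos : 0 < ‖x i + x j‖ := norm_pos_iff.mpr h0
  change ‖G x‖ ≤ ‖B _ _‖
  rw [hBsmull, hBsmulr, norm_mul, norm_mul, norm_inv, Complex.norm_real, norm_norm,
    ← mul_assoc, ← mul_inv, ← sq, le_inv_mul_iff₀ (by positivity), mul_comm]
  exact h2

/-- **Banach's theorem** on symmetric multilinear forms: a continuous multilinear form on a
finite-dimensional complex inner product space attains its norm at a tuple of unit vectors that
agree in any two arguments whose exchange leaves the form invariant. -/
theorem exists_unit_isMax_of_swap_invariant [DecidableEq ι] [InnerProductSpace ℂ E]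
    [FiniteDimensional ℂ E] [Nontrivial E] (G : MultilinearMap ℂ (fun _ : ι => E) ℂ) (hG : Continuous G) :
    ∃ x : ι → E, (∀ k, ‖x k‖ = 1) ∧ (∀ y : ι → E, (∀ k, ‖y k‖ = 1) → ‖G y‖ ≤ ‖G x‖) ∧
      ∀ i j, (∀ y : ι → E, G (y ∘ Equiv.swap i j) = G y) → x i = x j := by
  have : ProperSpace E := FiniteDimensional.proper ℂ E
  have hScomp : IsCompact {x : ι → E | ∀ k, ‖x k‖ = 1} := by
    convert! isCompact_univ_pi (fun _ : ι => isCompact_sphere (0 : E) 1) using 1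
    ext x
    simp
  obtain ⟨u, hu⟩ := exists_norm_eq E (c := 1) zero_le_one
  obtain ⟨a, ha, hamax⟩ := hScomp.exists_isMaxOn ⟨fun _ => u, fun _ => hu⟩
    (f := fun x => ‖G x‖) (by fun_prop)
  have ha : ∀ k, ‖a k‖ = 1 := ha
  have hamax : ∀ y : ι → E, (∀ k, ‖y k‖ = 1) → ‖G y‖ ≤ ‖G a‖ := fun y hy => hamax hy
  -- Phases can be moved between slots without changing `‖G‖`, so `x i + x j` might vanish. The
  -- functional `f` serves to fix the phases.
  obtain ⟨f, hf⟩ := Module.exists_dual_forall_apply_ne_zero (K := ℂ) a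
    (fun k => by rw [← norm_ne_zero_iff, ha]; exact one_ne_zero)
  have hfc : Continuous f := f.continuous_of_finiteDimensional
  -- rotate each vector so that `f` takes a positive value at it
  obtain ⟨b, hb, hbG, hbf⟩ : ∃ b : ι → E, (∀ k, ‖b k‖ = 1) ∧ ‖G b‖ = ‖G a‖ ∧
      ∀ k, 0 < (f (b k)).re := by
    have hc : ∀ k, ‖(‖f (a k)‖ : ℂ) / f (a k)‖ = 1 := fun k => by
      rw [norm_div, Complex.norm_real, norm_norm, div_self (norm_ne_zero_iff.mpr (hf k))]
    refine ⟨fun k => ((‖f (a k)‖ : ℂ) / f (a k)) • a k, fun k => ?_, ?_, fun k => ?_⟩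
    · rw [norm_smul, hc, ha, one_mul]
    · rw [G.map_smul_univ, norm_smul, norm_prod, Finset.prod_congr rfl fun k _ => hc k]
      simp
    · rw [map_smul, smul_eq_mul, div_mul_cancel₀ _ (hf k), Complex.ofReal_re]
      exact norm_pos_iff.mpr (hf k)
  obtain ⟨δ, hδ, hδb⟩ : ∃ δ : ℝ, 0 < δ ∧ ∀ k, δ ≤ (f (b k)).re := by
    rcases isEmpty_or_nonempty ι with h | h
    · exact ⟨1, one_pos, fun k => h.elim k⟩
    · obtain ⟨k, hk⟩ := Finite.exists_min fun k => (f (b k)).re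
      exact ⟨_, hbf k, hk⟩
  -- The uniform bound `δ` keeps the constraint closed, hence `K` compact, and still forces `x i + x
  -- j ≠ 0`.
  set K : Set (ι → E) := {x | ∀ k, ‖x k‖ = 1} ∩ ({x | ‖G a‖ ≤ ‖G x‖} ∩
    {x | ∀ k, δ ≤ (f (x k)).re}) with hK
  have hKcomp : IsCompact K := by
    refine hScomp.inter_right (IsClosed.inter ?_ ?_)
    · exact isClosed_le continuous_const hG.norm
    · rw [Set.ofPred_forall]
      exact isClosed_iInter fun k => isClosed_le continuous_const (by fun_prop)
  obtain ⟨x, ⟨hx, hxG, hxδ⟩, hxmax⟩ := hKcomp.exists_isMaxOn ⟨b, hb, hbG.ge, hδb⟩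
    (f := fun x => ∑ k, (f (x k)).re) (by fun_prop)
  have hx : ∀ k, ‖x k‖ = 1 := hx
  have hxG : ‖G a‖ ≤ ‖G x‖ := hxG
  have hxδ : ∀ k, δ ≤ (f (x k)).re := hxδ
  have hmax : ∀ y : ι → E, (∀ k, ‖y k‖ = 1) → ‖G y‖ ≤ ‖G x‖ :=
    fun y hy => (hamax y hy).trans hxG
  refine ⟨x, hx, hmax, fun i j hswap => ?_⟩
  by_contra hne
  have hij : i ≠ j := fun h => hne (h ▸ rfl)
  have hfpos : 2 * δ ≤ (f (x i + x j)).re := by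
    rw [map_add, Complex.add_re]
    linarith [hxδ i, hxδ j]
  have h0 : x i + x j ≠ 0 := fun h => by
    rw [h, map_zero, Complex.zero_re] at hfpos
    linarith
  have hpos : 0 < ‖x i + x j‖ := norm_pos_iff.mpr h0
  have hlt : ‖x i + x j‖ < 2 := by
    have hpar := parallelogram_law_with_norm ℂ (x i) (x j)
    rw [hx i, hx j] at hpar
    have : 0 < ‖x i - x j‖ := norm_pos_iff.mpr (sub_ne_zero.mpr hne)
    nlinarith
  set v : E := ((‖x i + x j‖ : ℝ) : ℂ)⁻¹ • (x i + x j) with hv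
  have hvnorm : ‖v‖ = 1 := by
    rw [hv, norm_smul, norm_inv, Complex.norm_real, norm_norm, inv_mul_cancel₀ hpos.ne']
  have hfv : (f v).re = ‖x i + x j‖⁻¹ * (f (x i + x j)).re := by
    rw [hv, map_smul, smul_eq_mul, ← Complex.ofReal_inv, Complex.re_ofReal_mul]
  -- Distinct unit vectors have a sum of norm below 2, so normalizing beats halving: replacing both
  -- by `v` stays in `K` and strictly increases the maximized sum.
  have hfv' : (f (x i + x j)).re < 2 * (f v).re := by
    rw [hfv, ← mul_assoc, ← div_eq_mul_inv]
    have : 1 < 2 / ‖x i + x j‖ := (one_lt_div hpos).mpr hlt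
    nlinarith
  set y := Function.update (Function.update x i v) j v with hy
  have hyk : ∀ k, y k = v ∨ y k = x k := by
    intro k
    by_cases hkj : k = j
    · left; simp [hy, hkj]
    · by_cases hki : k = i
      · left; simp [hy, hki, Function.update_of_ne hij]
      · right; simp [hy, hkj, hki]
  have hyK : y ∈ K := by
    refine ⟨fun k => ?_, le_trans (b := ‖G x‖) hxG ?_, fun k => ?_⟩
    · rcases hyk k with h | h
      · rw [h, hvnorm]
      · rw [h, hx]
    · exact norm_le_norm_update_normalize_add G hx hmax hij hswap h0
    · rcases hyk k with h | h
      · rw [h]; linarith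
      · rw [h]; exact hxδ k
  have hle : ∑ k, (f (y k)).re ≤ ∑ k, (f (x k)).re := hxmax hyK
  have hsplit : ∀ z : ι → E, ∑ k, (f (z k)).re = (f (z j)).re + ((f (z i)).re +
      ∑ k ∈ (Finset.univ.erase j).erase i, (f (z k)).re) := fun z => by
    rw [Finset.add_sum_erase _ (fun k => (f (z k)).re)
      (Finset.mem_erase.mpr ⟨hij, Finset.mem_univ i⟩),
      Finset.add_sum_erase _ (fun k => (f (z k)).re) (Finset.mem_univ j)]
  have hrest : ∑ k ∈ (Finset.univ.erase j).erase i, (f (y k)).re =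
      ∑ k ∈ (Finset.univ.erase j).erase i, (f (x k)).re := by
    refine Finset.sum_congr rfl fun k hk => ?_
    simp only [Finset.mem_erase] at hk
    simp [hy, hk.1, hk.2.1]
  have hyi : y i = v := by simp [hy, Function.update_of_ne hij]
  have hyj : y j = v := by simp [hy]
  rw [hsplit y, hsplit x, hrest, hyi, hyj] at hle
  rw [map_add, Complex.add_re] at hfv'
  linarith

end Banach

/-! ### Duality of the spectral and nuclear norms. -/

section TensorNorms

variable {ι : Type} [Fintype ι] {n : ℕ}

theorem conj_tInner [DecidableEq ι] (T Y : Tensor ι n) : conj (tInner T Y) = tInner Y T := by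
  simp [tInner, mul_comm]

theorem tInner_sum_left [DecidableEq ι] {α : Type*} (s : Finset α) (T : α → Tensor ι n)
    (Y : Tensor ι n) : tInner (∑ i ∈ s, T i) Y = ∑ i ∈ s, tInner (T i) Y := by
  simp only [tInner, Finset.sum_apply, Finset.sum_mul]
  exact Finset.sum_comm

theorem tInner_smul_right [DecidableEq ι] (c : ℂ) (T Y : Tensor ι n) :
    tInner T (c • Y) = conj c * tInner T Y := by
  simp only [tInner, Pi.smul_apply, smul_eq_mul, map_mul, Finset.mul_sum]
  exact Finset.sum_congr rfl fun I _ => by ring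

theorem tInner_add_right [DecidableEq ι] (T Y Z : Tensor ι n) :
    tInner T (Y + Z) = tInner T Y + tInner T Z := by
  simp [tInner, mul_add, Finset.sum_add_distrib]

theorem exists_tInner_eq [DecidableEq ι] (f : Tensor ι n →ₗ[ℂ] ℂ) :
    ∃ Y : Tensor ι n, ∀ T, f T = tInner T Y := by
  refine ⟨fun I => conj (f (Pi.single I 1)), fun T => ?_⟩
  conv_lhs => rw [pi_eq_sum_univ' T]
  simp [tInner]

/-- The multilinear form `x ↦ ⟨⊗_k x_k, Y⟩`. -/
noncomputable def pureForm [DecidableEq ι] (Y : Tensor ι n) :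
    MultilinearMap ℂ (fun _ : ι => EuclideanSpace ℂ (Fin n)) ℂ :=
  ∑ I, conj (Y I) • (MultilinearMap.mkPiAlgebra ℂ ι ℂ).compLinearMap
    fun k => (EuclideanSpace.proj (I k) : EuclideanSpace ℂ (Fin n) →L[ℂ] ℂ).toLinearMap

theorem pureForm_apply [DecidableEq ι] (Y : Tensor ι n) (x : ι → EuclideanSpace ℂ (Fin n)) :
    pureForm Y x = tInner (pureTensor x) Y := by
  simp [pureForm, tInner, pureTensor, mul_comm]

theorem norm_pureForm [DecidableEq ι] (Y : Tensor ι n) (x : ι → EuclideanSpace ℂ (Fin n)) :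
    ‖pureForm Y x‖ = ‖tInner Y (pureTensor x)‖ := by
  rw [pureForm_apply, ← conj_tInner, RCLike.norm_conj]

theorem continuous_pureTensor :
    Continuous (pureTensor : (ι → EuclideanSpace ℂ (Fin n)) → Tensor ι n) := by
  unfold pureTensor
  fun_prop

theorem continuous_pureForm [DecidableEq ι] (Y : Tensor ι n) : Continuous (pureForm Y) := by
  have : ⇑(pureForm Y) = fun x => tInner (pureTensor x) Y := funext (pureForm_apply Y)
  rw [this]
  unfold tInner
  have := continuous_pureTensor (ι := ι) (n := n)
  fun_prop

theorem pureForm_comp_perm [DecidableEq ι] (Y : Tensor ι n) (e : Equiv.Perm ι)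
    (x : ι → EuclideanSpace ℂ (Fin n)) :
    pureForm Y (x ∘ e) = pureForm (fun I => Y (I ∘ e)) x := by
  simp only [pureForm_apply, tInner, pureTensor]
  rw [← (e.symm.arrowCongr (Equiv.refl (Fin n))).sum_comp]
  refine Finset.sum_congr rfl fun I _ => ?_
  congr 1
  exact Equiv.prod_comp e fun k => x k (I k)

/-- The spectral norm is attained at unit vectors that agree in any two modes whose exchange
leaves the tensor invariant. -/
theorem exists_spectralNorm_eq [DecidableEq ι] [NeZero n] (Y : Tensor ι n) :
    ∃ x : ι → EuclideanSpace ℂ (Fin n), (∀ k, ‖x k‖ = 1) ∧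
      spectralNorm Y = ‖tInner Y (pureTensor x)‖ ∧
      (∀ y : ι → EuclideanSpace ℂ (Fin n), (∀ k, ‖y k‖ = 1) →
        ‖tInner Y (pureTensor y)‖ ≤ spectralNorm Y) ∧
      ∀ i j, (∀ I : ι → Fin n, Y (I ∘ Equiv.swap i j) = Y I) → x i = x j := by
  obtain ⟨x, hx, hmax, hswap⟩ :=
    exists_unit_isMax_of_swap_invariant (pureForm Y) (continuous_pureForm Y)
  simp only [norm_pureForm] at hmax
  have heq : spectralNorm Y = ‖tInner Y (pureTensor x)‖ := by
    refine IsGreatest.csSup_eq ⟨⟨x, hx, rfl⟩, ?_⟩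
    rintro r ⟨y, hy, rfl⟩
    exact hmax y hy
  refine ⟨x, hx, heq, fun y hy => heq ▸ hmax y hy, fun i j hY => hswap i j fun y => ?_⟩
  rw [pureForm_comp_perm, funext hY]

theorem nuclearNorm_le {α : Type*} [Fintype α] {T : Tensor ι n}
    (x : α → ι → EuclideanSpace ℂ (Fin n)) (hT : T = ∑ i, pureTensor (x i)) :
    nuclearNorm T ≤ ∑ i, ∏ k, ‖x i k‖ := by
  refine csInf_le ⟨0, ?_⟩ ⟨Fintype.card α, x ∘ (Fintype.equivFin α).symm, ?_, ?_⟩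
  · rintro s ⟨r, x, -, rfl⟩
    positivity
  · rw [hT]
    exact ((Fintype.equivFin α).symm.sum_comp fun i => pureTensor (x i)).symm
  · exact ((Fintype.equivFin α).symm.sum_comp fun i => ∏ k, ‖x i k‖).symm

theorem nuclearNorm_nonneg (T : Tensor ι n) : 0 ≤ nuclearNorm T := by
  refine Real.sInf_nonneg ?_
  rintro s ⟨r, x, -, rfl⟩
  positivity

/-- This keeps the infimum in `nuclearNorm` from being the default value at the empty set. A mode is
needed to carry the coefficient: with no modes every pure tensor equals 1. -/
theorem exists_eq_sum_pureTensor [Nonempty ι] (T : Tensor ι n) :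
    ∃ (r : ℕ) (x : Fin r → ι → EuclideanSpace ℂ (Fin n)), T = ∑ i, pureTensor (x i) := by
  classical
  let k₀ : ι := Classical.arbitrary ι
  let x : (ι → Fin n) → ι → EuclideanSpace ℂ (Fin n) := fun I k =>
    (if k = k₀ then T I else 1) • EuclideanSpace.single (I k) (1 : ℂ)
  refine ⟨Fintype.card (ι → Fin n), x ∘ (Fintype.equivFin _).symm, ?_⟩
  rw [show T = ∑ I, pureTensor (x I) from ?_]
  · exact ((Fintype.equivFin (ι → Fin n)).symm.sum_comp fun i => pureTensor (x i)).symm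
  · funext J
    have hx : ∀ I, pureTensor (x I) J = if I = J then T I else 0 := by
      intro I
      simp only [pureTensor, x, PiLp.smul_apply, smul_eq_mul, Finset.prod_mul_distrib,
        Finset.prod_ite_eq', Finset.mem_univ, if_true, PiLp.single_apply, Finset.prod_ite_zero,
        Finset.prod_const_one]
      by_cases h : I = J
      · simp [h]
      · rw [if_neg h, if_neg, mul_zero]
        exact fun h' => h (funext fun k => (h' k trivial).symm)
    simp [hx]

/-- The spectral norm and the nuclear norm are dual to each other. -/
theorem norm_tInner_le [DecidableEq ι] [Nonempty ι] [NeZero n] (T Y : Tensor ι n) :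
    ‖tInner T Y‖ ≤ nuclearNorm T * spectralNorm Y := by
  obtain ⟨z, hz, hzY, hmax, -⟩ := exists_spectralNorm_eq Y
  have hbound : ∀ x : ι → EuclideanSpace ℂ (Fin n),
      ‖tInner (pureTensor x) Y‖ ≤ spectralNorm Y * ∏ k, ‖x k‖ := fun x => by
    rw [← pureForm_apply]
    exact norm_le_mul_prod_norm_of_unit _ (fun y hy => by rw [norm_pureForm]; exact hmax y hy) x
  have hdec : ∀ (r : ℕ) (x : Fin r → ι → EuclideanSpace ℂ (Fin n)), T = ∑ i, pureTensor (x i) →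
      ‖tInner T Y‖ ≤ spectralNorm Y * ∑ i, ∏ k, ‖x i k‖ := by
    intro r x hT
    rw [hT, tInner_sum_left, Finset.mul_sum]
    exact (norm_sum_le _ _).trans (Finset.sum_le_sum fun i _ => hbound _)
  obtain ⟨r, x, hT⟩ := exists_eq_sum_pureTensor T
  -- Passing to the infimum divides by `spectralNorm Y`, so the value zero is treated apart.
  rcases (hzY ▸ norm_nonneg _ : 0 ≤ spectralNorm Y).eq_or_lt with h0 | hpos
  · simpa [← h0] using hdec r x hT
  · rw [← div_le_iff₀ hpos]
    refine le_csInf ⟨_, r, x, hT, rfl⟩ ?_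
    rintro s ⟨r, x, hT, rfl⟩
    rw [div_le_iff₀ hpos, mul_comm]
    exact hdec r x hT

end TensorNorms

open scoped Pointwise

/-! ### Bisymmetric tensors. -/

section Bisymmetric

variable {d n : ℕ}

theorem biPow_apply (x y : EuclideanSpace ℂ (Fin n)) (I : Fin d ⊕ Fin d → Fin n) :
    biPow d x y I = (∏ k, x (I (Sum.inl k))) * ∏ k, y (I (Sum.inr k)) := by
  simp [biPow, pureTensor, Fintype.prod_sum_type]

theorem biPow_smul_left (c : ℂ) (x y : EuclideanSpace ℂ (Fin n)) :
    biPow d (c • x) y = c ^ d • biPow d x y := by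
  funext I
  simp [biPow_apply, Finset.prod_mul_distrib, mul_assoc]

theorem prod_norm_elim (x y : EuclideanSpace ℂ (Fin n)) :
    ∏ k, ‖(Sum.elim (fun _ => x) (fun _ => y) : Fin d ⊕ Fin d → EuclideanSpace ℂ (Fin n)) k‖ =
      ‖x‖ ^ d * ‖y‖ ^ d := by
  simp [Fintype.prod_sum_type]

theorem biPow_mem_bisymmetric (x y : EuclideanSpace ℂ (Fin n)) :
    biPow d x y ∈ bisymmetric d n := by
  intro σ τ I
  simp only [biPow_apply, Function.comp_apply, Sum.map_inl, Sum.map_inr]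
  rw [Equiv.prod_comp σ fun k => x (I (Sum.inl k)), Equiv.prod_comp τ fun k => y (I (Sum.inr k))]

/-- The orthogonal projection onto the bisymmetric tensors. -/
noncomputable def bisymmetrize (Y : BiTensor d n) : BiTensor d n := fun I =>
  ((Fintype.card (Equiv.Perm (Fin d) × Equiv.Perm (Fin d)) : ℝ) : ℂ)⁻¹ *
    ∑ p : Equiv.Perm (Fin d) × Equiv.Perm (Fin d), Y (I ∘ Sum.map p.1 p.2)

theorem bisymmetrize_mem (Y : BiTensor d n) : bisymmetrize Y ∈ bisymmetric d n := by
  intro σ τ I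
  simp only [bisymmetrize]
  congr 1
  rw [← Equiv.sum_comp (Equiv.mulLeft (σ, τ)) fun p => Y (I ∘ Sum.map p.1 p.2)]
  refine Finset.sum_congr rfl fun p _ => ?_
  rw [Function.comp_assoc, Sum.map_comp_map]
  rfl

/-- Reindexing moves each permutation onto `T`, which absorbs it. Any functional on bisymmetric
tensors is therefore represented by a bisymmetric tensor. -/
theorem tInner_bisymmetrize {T : BiTensor d n} (hT : T ∈ bisymmetric d n) (Y : BiTensor d n) :
    tInner T (bisymmetrize Y) = tInner T Y := by
  have hp : ∀ p : Equiv.Perm (Fin d) × Equiv.Perm (Fin d),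
      ∑ I, T I * conj (Y (I ∘ Sum.map p.1 p.2)) = tInner T Y := by
    intro p
    rw [tInner, ← Equiv.sum_comp ((Equiv.sumCongr p.1 p.2).symm.arrowCongr (Equiv.refl (Fin n)))
      fun I => T I * conj (Y I)]
    refine Finset.sum_congr rfl fun I _ => ?_
    rw [← hT p.1 p.2 I]
    rfl
  have hcard : ((Fintype.card (Equiv.Perm (Fin d) × Equiv.Perm (Fin d)) : ℝ) : ℂ) ≠ 0 := by
    exact_mod_cast Fintype.card_ne_zero
  calc tInner T (bisymmetrize Y)
      = ((Fintype.card (Equiv.Perm (Fin d) × Equiv.Perm (Fin d)) : ℝ) : ℂ)⁻¹ *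
          ∑ p : Equiv.Perm (Fin d) × Equiv.Perm (Fin d),
            ∑ I, T I * conj (Y (I ∘ Sum.map p.1 p.2)) := by
        rw [Finset.sum_comm, Finset.mul_sum]
        refine Finset.sum_congr rfl fun I _ => ?_
        rw [bisymmetrize, map_mul, map_inv₀, Complex.conj_ofReal, map_sum, ← Finset.mul_sum]
        ring
    _ = tInner T Y := by
        rw [Finset.sum_congr rfl fun p _ => hp p, Finset.sum_const, Finset.card_univ,
          nsmul_eq_mul, ← Complex.ofReal_natCast, inv_mul_cancel_left₀ hcard]

theorem exists_unit_pow_mul_eq_norm (hd : d ≠ 0) (z : ℂ) :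
    ∃ c : ℂ, ‖c‖ = 1 ∧ c ^ d * z = ‖z‖ := by
  by_cases hz : z = 0
  · exact ⟨1, by simp, by simp [hz]⟩
  · obtain ⟨c, hc⟩ := IsAlgClosed.exists_pow_nat_eq ((‖z‖ : ℂ) / z) (Nat.pos_of_ne_zero hd)
    refine ⟨c, ?_, by rw [hc, div_mul_cancel₀ _ hz]⟩
    rw [← pow_eq_one_iff_of_nonneg (norm_nonneg c) hd, ← norm_pow, hc, norm_div,
      Complex.norm_real, norm_norm, div_self (norm_ne_zero_iff.mpr hz)]

theorem isGreatest_spectralNorm_biPow [NeZero d] [NeZero n] {C : BiTensor d n}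
    (hC : C ∈ bisymmetric d n) :
    IsGreatest {r : ℝ | ∃ x y : EuclideanSpace ℂ (Fin n), ‖x‖ = 1 ∧ ‖y‖ = 1 ∧
      r = (tInner C (biPow d x y)).re} (spectralNorm C) := by
  obtain ⟨z, hz, hzC, hmax, hswap⟩ := exists_spectralNorm_eq C
  have hl : ∀ k, z (Sum.inl k) = z (Sum.inl 0) := fun k => hswap _ _ fun I => by
    rw [← hC (Equiv.swap k 0) 1 I, ← Equiv.Perm.sumCongr_swap_one]
    rfl
  have hr : ∀ k, z (Sum.inr k) = z (Sum.inr 0) := fun k => hswap _ _ fun I => by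
    rw [← hC 1 (Equiv.swap k 0) I, ← Equiv.Perm.sumCongr_one_swap]
    rfl
  have hzpow : pureTensor z = biPow d (z (Sum.inl 0)) (z (Sum.inr 0)) := by
    rw [biPow]
    congr 1
    funext k
    rcases k with k | k
    · exact hl k
    · exact hr k
  constructor
  · obtain ⟨c, hc, hcz⟩ := exists_unit_pow_mul_eq_norm (NeZero.ne d)
      (tInner C (biPow d (z (Sum.inl 0)) (z (Sum.inr 0))))
    -- The conjugate compensates for the conjugate-linear second argument of `tInner`.
    refine ⟨conj c • z (Sum.inl 0), z (Sum.inr 0), ?_, hz _, ?_⟩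
    · rw [norm_smul, RCLike.norm_conj, hc, hz, one_mul]
    · rw [biPow_smul_left, tInner_smul_right, map_pow, Complex.conj_conj, hcz, hzC, hzpow,
        Complex.ofReal_re]
  · rintro r ⟨x, y, hx, hy, rfl⟩
    refine (Complex.re_le_norm _).trans (hmax _ ?_)
    rintro (k | k)
    · exact hx
    · exact hy

/-- The tensors `(⊗^d x) ⊗ (⊗^d y)` of unit vectors. -/
def biPowSet (d n : ℕ) : Set (BiTensor d n) :=
  {E | ∃ x y : EuclideanSpace ℂ (Fin n), ‖x‖ = 1 ∧ ‖y‖ = 1 ∧ E = biPow d x y}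

theorem isCompact_biPowSet : IsCompact (biPowSet d n) := by
  have hc : Continuous fun p : EuclideanSpace ℂ (Fin n) × EuclideanSpace ℂ (Fin n) =>
      biPow d p.1 p.2 := by
    refine continuous_pureTensor.comp (continuous_pi ?_)
    rintro (k | k)
    · exact continuous_fst
    · exact continuous_snd
  convert! ((isCompact_sphere (0 : EuclideanSpace ℂ (Fin n)) 1).prod
    (isCompact_sphere (0 : EuclideanSpace ℂ (Fin n)) 1)).image hc using 1
  ext E
  simp [biPowSet, eq_comm]

/-- A bisymmetric tensor of nuclear norm `N` lies in `N` times the convex hull of the tensors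
`(⊗^d x) ⊗ (⊗^d y)` of unit vectors. -/
theorem mem_nuclearNorm_smul_convexHull [NeZero d] [NeZero n] {C : BiTensor d n}
    (hC : C ∈ bisymmetric d n) : C ∈ nuclearNorm C • convexHull ℝ (biPowSet d n) := by
  by_contra hnot
  obtain ⟨f, u, hfu, huC⟩ := RCLike.geometric_hahn_banach_closed_point (𝕜 := ℂ)
    ((convex_convexHull ℝ (biPowSet d n)).smul (nuclearNorm C))
    ((isCompact_convexHull_of_finiteDimensional isCompact_biPowSet).smul (nuclearNorm C)).isClosed
    hnot
  obtain ⟨Y, hY⟩ := exists_tInner_eq f.toLinearMap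
  have hY : ∀ T ∈ bisymmetric d n, f T = tInner T (bisymmetrize Y) := fun T hT => by
    rw [tInner_bisymmetrize hT]
    exact hY T
  -- At this point of the hull the functional, scaled by `nuclearNorm C`, already reaches the
  -- duality bound for `C`, so it cannot separate strictly.
  obtain ⟨x, y, hx, hy, hxy⟩ := (isGreatest_spectralNorm_biPow (bisymmetrize_mem Y)).1
  have h1 := hfu _ (Set.smul_mem_smul_set (subset_convexHull ℝ _ ⟨x, y, hx, hy, rfl⟩))
  rw [f.map_smul_of_tower, hY _ (biPow_mem_bisymmetric x y), ← conj_tInner, RCLike.smul_re] at h1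
  have h2 : RCLike.re (f C) ≤ nuclearNorm C * spectralNorm (bisymmetrize Y) := by
    rw [hY C hC]
    exact (Complex.re_le_norm _).trans (norm_tInner_le _ _)
  rw [hxy] at h2
  have h3 : RCLike.re (conj (tInner (bisymmetrize Y) (biPow d x y))) =
    (tInner (bisymmetrize Y) (biPow d x y)).re := Complex.conj_re _
  rw [h3] at h1
  exact absurd (h1.trans huC) h2.not_gt

/-- Homogeneity of degree `d` in the first argument lets a `d`-th root of each weight `N * w i` be
absorbed into `x i`. It serves both `biPow` and `hermPow`. -/
theorem exists_sum_of_mem_smul_convexHull [NeZero d] {F : Type*} [AddCommGroup F] [Module ℝ F]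
    {P : EuclideanSpace ℂ (Fin n) → EuclideanSpace ℂ (Fin n) → F}
    (hP : ∀ (t : ℝ) x y, P ((t : ℂ) • x) y = t ^ d • P x y) {A : F} {N : ℝ} (hN : 0 ≤ N)
    (hA : A ∈ N • convexHull ℝ {E | ∃ x y, ‖x‖ = 1 ∧ ‖y‖ = 1 ∧ E = P x y}) :
    ∃ (M : ℕ) (x y : Fin M → EuclideanSpace ℂ (Fin n)),
      A = ∑ i, P (x i) (y i) ∧ N = ∑ i, ‖x i‖ ^ d * ‖y i‖ ^ d := by
  obtain ⟨B, hB, rfl⟩ := hA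
  obtain ⟨α, _, w, z, hw, hw1, hz, rfl⟩ := mem_convexHull_iff_exists_fintype.mp hB
  choose x y hx hy hxy using hz
  have hroot : ∀ i, ((N * w i) ^ ((d : ℝ)⁻¹)) ^ d = N * w i := fun i =>
    Real.rpow_inv_natCast_pow (mul_nonneg hN (hw i)) (NeZero.ne d)
  let e := (Fintype.equivFin α).symm
  refine ⟨Fintype.card α, fun i => (((N * w (e i)) ^ ((d : ℝ)⁻¹) : ℝ) : ℂ) • x (e i),
    fun i => y (e i), ?_, ?_⟩
  · simp only [hP, hroot, ← hxy]
    rw [Equiv.sum_comp e fun i => (N * w i) • z i]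
    simp [Finset.smul_sum, mul_smul]
  · have hterm : ∀ i, ‖(((N * w i) ^ ((d : ℝ)⁻¹) : ℝ) : ℂ) • x i‖ ^ d * ‖y i‖ ^ d = N * w i := by
      intro i
      rw [norm_smul, hx, hy, Complex.norm_real, Real.norm_of_nonneg
        (Real.rpow_nonneg (mul_nonneg hN (hw i)) _), mul_one, hroot, one_pow, mul_one]
    simp only [hterm]
    rw [Equiv.sum_comp e fun i => N * w i, ← Finset.mul_sum, hw1, mul_one]

theorem biPow_real_smul_left (t : ℝ) (x y : EuclideanSpace ℂ (Fin n)) :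
    biPow d ((t : ℂ) • x) y = t ^ d • biPow d x y := by
  rw [biPow_smul_left, ← Complex.ofReal_pow]
  rfl

theorem isLeast_nuclearNorm_biPow [NeZero d] [NeZero n] {C : BiTensor d n}
    (hC : C ∈ bisymmetric d n) :
    IsLeast {s : ℝ | ∃ (M : ℕ) (x y : Fin M → EuclideanSpace ℂ (Fin n)),
      C = ∑ i, biPow d (x i) (y i) ∧ s = ∑ i, ‖x i‖ ^ d * ‖y i‖ ^ d} (nuclearNorm C) := by
  refine ⟨exists_sum_of_mem_smul_convexHull biPow_real_smul_left (nuclearNorm_nonneg C)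
    (mem_nuclearNorm_smul_convexHull hC), ?_⟩
  rintro s ⟨M, x, y, hxy, rfl⟩
  refine (nuclearNorm_le _ hxy).trans (le_of_eq ?_)
  simp only [prod_norm_elim]

end Bisymmetric

/-! ### Hermitian bisymmetric tensors. -/

section Hermitian

variable {d n : ℕ}

/-- The conjugate transpose of a tensor. -/
noncomputable def adjoint : BiTensor d n →ₗ[ℝ] BiTensor d n where
  toFun A I := conj (A (I ∘ Sum.swap))
  map_add' A B := by
    funext I
    simp
  map_smul' c A := by
    funext I
    simp

theorem adjoint_apply (A : BiTensor d n) (I : Fin d ⊕ Fin d → Fin n) :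
    adjoint A I = conj (A (I ∘ Sum.swap)) := rfl

theorem comp_swap_comp_swap (I : Fin d ⊕ Fin d → Fin n) : (I ∘ Sum.swap) ∘ Sum.swap = I := by
  rw [Function.comp_assoc, Sum.swap_swap_eq, Function.comp_id]

theorem mem_hermitian_iff {A : BiTensor d n} : A ∈ hermitian d n ↔ adjoint A = A := by
  constructor
  · intro hA
    funext I
    rw [adjoint_apply, hA I, Complex.conj_conj]
  · intro hA I
    conv_rhs => rw [← hA, adjoint_apply, Complex.conj_conj]

theorem adjoint_adjoint (A : BiTensor d n) : adjoint (adjoint A) = A := by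
  funext I
  rw [adjoint_apply, adjoint_apply, comp_swap_comp_swap, Complex.conj_conj]

theorem adjoint_biPow (x y : EuclideanSpace ℂ (Fin n)) :
    adjoint (biPow d x y) = biPow d (conjVec y) (conjVec x) := by
  funext I
  simp [adjoint_apply, biPow_apply, conjVec, mul_comm]

theorem norm_conjVec (x : EuclideanSpace ℂ (Fin n)) : ‖conjVec x‖ = ‖x‖ := by
  simp [EuclideanSpace.norm_eq, conjVec]

theorem tInner_adjoint {A : BiTensor d n} (hA : A ∈ hermitian d n) (B : BiTensor d n) :
    tInner A (adjoint B) = conj (tInner A B) := by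
  simp only [tInner, map_sum]
  rw [← Equiv.sum_comp ((Equiv.sumComm (Fin d) (Fin d)).arrowCongr (Equiv.refl (Fin n)))]
  refine Finset.sum_congr rfl fun I _ => ?_
  change A (I ∘ Sum.swap) * conj (conj (B ((I ∘ Sum.swap) ∘ Sum.swap))) = _
  rw [comp_swap_comp_swap, hA I, map_mul]

/-- The real-linear projection onto the hermitian tensors. -/
noncomputable def hermPart : BiTensor d n →ₗ[ℝ] BiTensor d n :=
  (1 / 2 : ℝ) • (LinearMap.id + adjoint)

theorem hermPart_apply (A : BiTensor d n) : hermPart A = (1 / 2 : ℝ) • (A + adjoint A) := rfl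

theorem hermPart_of_mem {A : BiTensor d n} (hA : A ∈ hermitian d n) : hermPart A = A := by
  rw [hermPart_apply, mem_hermitian_iff.mp hA, ← two_smul ℝ A, smul_smul]
  norm_num

theorem hermPart_mem (A : BiTensor d n) : hermPart A ∈ hermitian d n := by
  rw [mem_hermitian_iff, hermPart_apply, map_smul, map_add, adjoint_adjoint, add_comm]

theorem hermPart_biPow (x y : EuclideanSpace ℂ (Fin n)) :
    hermPart (biPow d x y) = hermPow d x y := by
  rw [hermPart_apply, hermPow, adjoint_biPow, ← Complex.coe_smul]
  norm_num

theorem hermPow_mem (x y : EuclideanSpace ℂ (Fin n)) :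
    hermPow d x y ∈ hermitianBisymmetric d n := by
  refine ⟨hermPart_biPow (d := d) x y ▸ hermPart_mem _, ?_⟩
  exact (bisymmetric d n).smul_mem _
    ((bisymmetric d n).add_mem (biPow_mem_bisymmetric _ _) (biPow_mem_bisymmetric _ _))

/-- The two halves of `hermPow` pair with `A` to conjugate numbers, whose mean is the common real
part. -/
theorem re_tInner_hermPow {A : BiTensor d n} (hA : A ∈ hermitian d n)
    (x y : EuclideanSpace ℂ (Fin n)) :
    (tInner A (hermPow d x y)).re = (tInner A (biPow d x y)).re := by
  rw [hermPow, ← adjoint_biPow, tInner_smul_right, tInner_add_right, tInner_adjoint hA,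
    Complex.add_conj]
  simp

theorem isGreatest_spectralNorm_hermPow [NeZero d] [NeZero n] {A : BiTensor d n}
    (hA : A ∈ hermitianBisymmetric d n) :
    IsGreatest {r : ℝ | ∃ x y : EuclideanSpace ℂ (Fin n), ‖x‖ = 1 ∧ ‖y‖ = 1 ∧
      r = (tInner A (hermPow d x y)).re} (spectralNorm A) := by
  simp only [re_tInner_hermPow hA.1]
  exact isGreatest_spectralNorm_biPow hA.2

theorem nuclearNorm_sum_hermPow_le [NeZero d] {M : ℕ} (x y : Fin M → EuclideanSpace ℂ (Fin n)) :
    nuclearNorm (∑ i, hermPow d (x i) (y i)) ≤ ∑ i, ‖x i‖ ^ d * ‖y i‖ ^ d := by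
  -- Each `hermPow` splits into two decomposable tensors; the factor `1 / 2` enters each through a
  -- `d`-th root on its first vector.
  have hroot : ((1 / 2 : ℝ) ^ ((d : ℝ)⁻¹)) ^ d = 1 / 2 :=
    Real.rpow_inv_natCast_pow (by norm_num) (NeZero.ne d)
  have hnonneg : 0 ≤ (1 / 2 : ℝ) ^ ((d : ℝ)⁻¹) := by positivity
  generalize (1 / 2 : ℝ) ^ ((d : ℝ)⁻¹) = c at hroot hnonneg
  refine (nuclearNorm_le (α := Fin M ⊕ Fin M)
    (Sum.elim (fun i => Sum.elim (fun _ => (c : ℂ) • x i) fun _ => y i)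
      (fun i => Sum.elim (fun _ => (c : ℂ) • conjVec (y i)) fun _ => conjVec (x i))) ?_).trans
    (le_of_eq ?_)
  · rw [Fintype.sum_sum_type]
    change _ = ∑ i, biPow d ((c : ℂ) • x i) (y i) +
      ∑ i, biPow d ((c : ℂ) • conjVec (y i)) (conjVec (x i))
    rw [← Finset.sum_add_distrib]
    refine Finset.sum_congr rfl fun i _ => ?_
    rw [biPow_real_smul_left, biPow_real_smul_left, hroot, ← smul_add, ← adjoint_biPow,
      ← hermPart_apply, hermPart_biPow]
  · rw [Fintype.sum_sum_type]
    simp only [Sum.elim_inl, Sum.elim_inr, prod_norm_elim, norm_conjVec]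
    rw [← Finset.sum_add_distrib]
    refine Finset.sum_congr rfl fun i _ => ?_
    rw [norm_smul, norm_smul, Complex.norm_real, Real.norm_of_nonneg hnonneg, mul_pow, mul_pow,
      hroot, norm_conjVec]
    ring

theorem isLeast_nuclearNorm_hermPow [NeZero d] [NeZero n] {A : BiTensor d n}
    (hA : A ∈ hermitianBisymmetric d n) :
    IsLeast {s : ℝ | ∃ (M : ℕ) (x y : Fin M → EuclideanSpace ℂ (Fin n)),
      A = ∑ i, hermPow d (x i) (y i) ∧ s = ∑ i, ‖x i‖ ^ d * ‖y i‖ ^ d} (nuclearNorm A) := by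
  constructor
  · obtain ⟨M, x, y, hxy, hs⟩ := (isLeast_nuclearNorm_biPow hA.2).1
    refine ⟨M, x, y, ?_, hs⟩
    rw [← hermPart_of_mem hA.1, hxy, map_sum]
    simp only [hermPart_biPow]
  · rintro s ⟨M, x, y, rfl, rfl⟩
    exact nuclearNorm_sum_hermPow_le x y

theorem hermPart_image_biPowSet : hermPart '' biPowSet d n = hermPowSet d n := by
  ext E
  constructor
  · rintro ⟨_, ⟨x, y, hx, hy, rfl⟩, rfl⟩
    exact ⟨x, y, hx, hy, hermPart_biPow x y⟩
  · rintro ⟨x, y, hx, hy, rfl⟩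
    exact ⟨_, ⟨x, y, hx, hy, rfl⟩, hermPart_biPow x y⟩

/-- With `c ^ d = -1`, scaling `x` by `c` turns `hermPow d x x` into its negative. Having 0 in the
hull allows shrinking by `nuclearNorm A ≤ 1`. -/
theorem zero_mem_convexHull_hermPowSet [NeZero d] [NeZero n] :
    (0 : BiTensor d n) ∈ convexHull ℝ (hermPowSet d n) := by
  obtain ⟨x, hx⟩ := exists_norm_eq (EuclideanSpace ℂ (Fin n)) (c := 1) zero_le_one
  obtain ⟨c, hc, hcd⟩ := exists_unit_pow_mul_eq_norm (NeZero.ne d) (-1 : ℂ)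
  have hcd : c ^ d = -1 := by
    rw [norm_neg, norm_one, Complex.ofReal_one] at hcd
    linear_combination -hcd
  have h1 : hermPow d x x ∈ convexHull ℝ (hermPowSet d n) :=
    subset_convexHull ℝ _ ⟨x, x, hx, hx, rfl⟩
  have h2 : -hermPow d x x ∈ convexHull ℝ (hermPowSet d n) := by
    refine subset_convexHull ℝ _ ⟨c • x, x, by rw [norm_smul, hc, hx, one_mul], hx, ?_⟩
    rw [← hermPart_biPow (c • x), biPow_smul_left, hcd, neg_one_smul, map_neg, hermPart_biPow]
  have h := convex_convexHull ℝ (hermPowSet d n) h1 h2 (a := 1 / 2) (b := 1 / 2)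
    (by norm_num) (by norm_num) (by norm_num)
  rwa [smul_neg, add_neg_cancel] at h

theorem hermPow_real_smul_left (t : ℝ) (x y : EuclideanSpace ℂ (Fin n)) :
    hermPow d ((t : ℂ) • x) y = t ^ d • hermPow d x y := by
  rw [← hermPart_biPow, biPow_real_smul_left, map_smul, hermPart_biPow]

theorem hermNuclearBall_eq_convexHull [NeZero d] [NeZero n] :
    hermNuclearBall d n = convexHull ℝ (hermPowSet d n) := by
  ext A
  constructor
  · rintro ⟨hA, hA1⟩
    obtain ⟨B, hB, hBA⟩ := mem_nuclearNorm_smul_convexHull hA.2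
    have hBA : nuclearNorm A • B = A := hBA
    rw [← hermPart_of_mem hA.1, ← hBA, map_smul]
    refine (convex_convexHull ℝ _).smul_mem_of_zero_mem zero_mem_convexHull_hermPowSet ?_
      ⟨nuclearNorm_nonneg A, hA1⟩
    rw [← hermPart_image_biPowSet, ← LinearMap.image_convexHull]
    exact Set.mem_image_of_mem _ hB
  · intro hA
    rw [← one_smul ℝ (convexHull ℝ (hermPowSet d n))] at hA
    obtain ⟨M, x, y, rfl, h1⟩ :=
      exists_sum_of_mem_smul_convexHull hermPow_real_smul_left zero_le_one hA
    exact ⟨Submodule.sum_mem _ fun i _ => hermPow_mem _ _,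
      (nuclearNorm_sum_hermPow_le x y).trans h1.ge⟩

end Hermitian

end BisymTensor

theorem mainTheorem7 (d n : ℕ) (hd : 1 ≤ d) (hn : 1 ≤ n) :
    (∀ C ∈ BisymTensor.bisymmetric d n,
      IsGreatest {r : ℝ | ∃ x y : EuclideanSpace ℂ (Fin n), ‖x‖ = 1 ∧ ‖y‖ = 1 ∧
          r = (BisymTensor.tInner C (BisymTensor.biPow d x y)).re}
        (BisymTensor.spectralNorm C) ∧
      IsLeast {s : ℝ | ∃ (M : ℕ) (x y : Fin M → EuclideanSpace ℂ (Fin n)),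
          C = ∑ i, BisymTensor.biPow d (x i) (y i) ∧ s = ∑ i, ‖x i‖ ^ d * ‖y i‖ ^ d}
        (BisymTensor.nuclearNorm C)) ∧
    (∀ A ∈ BisymTensor.hermitianBisymmetric d n,
      IsGreatest {r : ℝ | ∃ x y : EuclideanSpace ℂ (Fin n), ‖x‖ = 1 ∧ ‖y‖ = 1 ∧
          r = (BisymTensor.tInner A (BisymTensor.hermPow d x y)).re}
        (BisymTensor.spectralNorm A) ∧
      IsLeast {s : ℝ | ∃ (M : ℕ) (x y : Fin M → EuclideanSpace ℂ (Fin n)),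
          A = ∑ i, BisymTensor.hermPow d (x i) (y i) ∧ s = ∑ i, ‖x i‖ ^ d * ‖y i‖ ^ d}
        (BisymTensor.nuclearNorm A)) ∧
    (BisymTensor.hermNuclearBall d n).extremePoints ℝ ⊆ BisymTensor.hermPowSet d n ∧
    BisymTensor.hermNuclearBall d n = convexHull ℝ (BisymTensor.hermPowSet d n) := by
  have : NeZero d := ⟨by omega⟩
  have : NeZero n := ⟨by omega⟩
  have hball := BisymTensor.hermNuclearBall_eq_convexHull (d := d) (n := n)
  refine ⟨fun C hC => ⟨BisymTensor.isGreatest_spectralNorm_biPow hC,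
    BisymTensor.isLeast_nuclearNorm_biPow hC⟩, fun A hA =>
    ⟨BisymTensor.isGreatest_spectralNorm_hermPow hA, BisymTensor.isLeast_nuclearNorm_hermPow hA⟩,
    ?_, hball⟩
  rw [hball]
  exact extremePoints_convexHull_subset
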